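/- Fix integers $T,N,d,k,m,m'\ge 0$ with $m\ge 2Nd$, $m'\ge 2k$, and a variance $v>0$. For a weighted adjacency matrix $A\in\mathbb R^{N\times N}$ let $\mathrm{graph}(A)$ be the directed graph on $\{1,\dots,N\}$ with $u\to w$ iff $A_{uw}\ne 0$. Let $\mathcal E$ be the set of two-layer ReLU perceptrons with biases and $m$ hidden units from $\mathbb R^{N\times d}$ to $\mathbb R^{N\times k}$, and $\mathcal D$ the set of two-layer ReLU perceptrons with biases and $m'$ hidden units from $\mathbb R^k$ to $\mathbb R^d$; maps $g:\mathbb R^k\to\mathbb R^d$ are applied to $N\times k$ matrices row by row. For such a $g$ and for $A$ with acyclic graph let $P_{g,A}$ be the law of $H=g\big((I-A^\top)^{-1}Z\big)+E\in\mathbb R^{N\times d}$, where $Z\in\mathbb R^{N\times k}$ has independent $\mathcal N(0,1)$ entries and $E$ is independent of $Z$ with independent $\mathcal N(0,v)$ entries. **Inner optimization.** Let $\mu^{(t)}$ be the law of the feature matrix $H^{(t)}\in\mathbb R^{N\times d}$ at time $t\in\{1,\dots,T\}$. At each $t$ the parameters are $f_{enc}\in\mathcal E$, an invertible $L\in\mathbb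 R^{Nk\times Nk}$, $f_{dec}\in\mathcal D$ and $A\in\mathbb R^{N\times N}$; the prior is $P(Z)=\mathcal N(0,I)$, the variational posterior is $Q(Z\mid H)=\mathcal N\big((I-A^\top)f_{enc}(H),\,LL^\top\big)$ and the likelihood is $P(H\mid Z)=\mathcal N\big(f_{dec}((I-A^\top)^{-1}Z),\,vI\big)$. The (population) loss is $$\mathcal L^{(t)}=\mathbb E_{H\sim\mu^{(t)}}\Big[D_{KL}\big(Q(Z\mid H)\,\|\,P(Z)\big)-\mathbb E_{Q(Z\mid H)}[\log P(H\mid Z)]\Big].$$ A family of parameters, one for each $t$, is feasible if $\sum_t\big(\mathrm{Tr}[(I+A^{(t)}\circ A^{(t)})^N]-N\big)=0$, and it solves the inner optimization if it is feasible and, for every $t$, its loss $\mathcal L^{(t)}$ is minimal among all feasible families. **Assumptions.** Let $S^{(t)}$ be directed graphs on $\{1,\dots,N\}$ such that for every $t$: 1. (The causal graph generates the features through normal distributions.) $S^{(t)}$ is acyclic and there are $A$ with $\mathrm{graph}(A)=S^{(t)}$, $V\in\mathbb R^{k\times d}$ and $c\in\mathbb R^d$ such that $\mu^{(t)}$ is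 the law of $H=XV+\mathbf 1c^\top+E$, where $X$ solves the linear structural equation model $X=A^\top X+Z$, and $Z,E$ are as above. 2. (Structural identifiability.) If $f\in\mathcal D$ and $A$ has an acyclic graph and $P_{f,A}=\mu^{(t)}$, then $\mathrm{graph}(A)=S^{(t)}$. **Theorem.** The inner optimization has a solution, and every solution satisfies $\mathrm{graph}(A^{(t)})=S^{(t)}$ for all $t\in\{1,\dots,T\}$. -/

import Mathlib

open MeasureTheory ProbabilityTheory
open scoped NNReal Matrix

noncomputable section

namespace InstantaneousCausality

/-- Feature matrices (one row of `d` features for each of `N` variables), indexed by their entries. -/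
abbrev Features (N d : ℕ) : Type := Fin N × Fin d → ℝ

/-- Left multiplication of a feature matrix by an `N × N` matrix. -/
def nodeMul {N d : ℕ} (B : Matrix (Fin N) (Fin N) ℝ) (x : Features N d) : Features N d :=
  fun p => ∑ u, B p.1 u * x (u, p.2)

/-- The directed graph of a weighted adjacency matrix: `u → v` when the effect `A u v` of `u` on `v`
is nonzero. -/
def graphOf {N : ℕ} (A : Matrix (Fin N) (Fin N) ℝ) : Digraph (Fin N) where
  Adj u v := A u v ≠ 0

/-- A digraph without directed cycles (in particular without self-loops). -/
def IsAcyclic {N : ℕ} (G : Digraph (Fin N)) : Prop :=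
  ∀ v, ¬ Relation.TransGen G.Adj v v

/-- The weights of a two-layer perceptron with `m` hidden units, from `ℝ^ι` to `ℝ^κ`. -/
structure MLP (ι κ : Type) (m : ℕ) where
  W₁ : Matrix (Fin m) ι ℝ
  b₁ : Fin m → ℝ
  W₂ : Matrix κ (Fin m) ℝ
  b₂ : κ → ℝ

/-- The function computed by a two-layer perceptron with ReLU activation. -/
def MLP.eval {ι κ : Type} [Fintype ι] {m : ℕ} (θ : MLP ι κ m) (x : ι → ℝ) : κ → ℝ :=
  θ.W₂ *ᵥ (fun r => max ((θ.W₁ *ᵥ x + θ.b₁) r) 0) + θ.b₂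

/-- The law of a matrix whose entries are independent centred Gaussians of variance `v`. -/
def noise (N d : ℕ) (v : ℝ≥0) : Measure (Features N d) :=
  Measure.pi fun _ => gaussianReal 0 v

/-- The standard Gaussian prior `P(Z)`. -/
def prior (N k : ℕ) : Measure (Features N k) := noise N k 1

/-- The solution `X = (I - Aᵀ)⁻¹ Z` of the linear structural equations `X = Aᵀ X + Z`. -/
def semSolution {N k : ℕ} (A : Matrix (Fin N) (Fin N) ℝ) (z : Features N k) : Features N k :=
  nodeMul (1 - Aᵀ)⁻¹ z

/-- The law of `H = g((I - Aᵀ)⁻¹ Z) + E`, where `g : ℝ^k → ℝ^d` acts on the row of every variable,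
`Z` is standard Gaussian and `E` is independent Gaussian noise of variance `v`. -/
def generatedLaw {N k d : ℕ} (v : ℝ≥0) (g : (Fin k → ℝ) → Fin d → ℝ)
    (A : Matrix (Fin N) (Fin N) ℝ) : Measure (Features N d) :=
  ((prior N k).prod (noise N d v)).map
    fun q p => g (fun j => semSolution A q.1 (p.1, j)) p.2 + q.2 p

/-- The parameters of the inner problem at one time: encoder, decoder and weighted adjacency matrix.
The encoder reads the whole feature matrix; the decoder is shared by the variables and acts on the
row of each of them. `scale` is the invertible factor of the covariance of the variational
posterior. -/
structure Params (N d k mEnc mDec : ℕ) where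
  enc : MLP (Fin N × Fin d) (Fin N × Fin k) mEnc
  scale : GL (Fin N × Fin k) ℝ
  dec : MLP (Fin k) (Fin d) mDec
  A : Matrix (Fin N) (Fin N) ℝ

variable {N d k mEnc mDec : ℕ}

/-- The variational posterior `Q(Z | H = h)`: the law of `(I - Aᵀ) f_enc(h) + L ξ` with `ξ` standard
Gaussian, i.e. the Gaussian with mean `(I - Aᵀ) f_enc(h)` and covariance `L Lᵀ`. -/
def posterior (p : Params N d k mEnc mDec) (h : Features N d) : Measure (Features N k) :=
  (prior N k).map fun ξ =>
    nodeMul (1 - p.Aᵀ) (p.enc.eval h) +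
      (p.scale : Matrix (Fin N × Fin k) (Fin N × Fin k) ℝ) *ᵥ ξ

/-- The density at `h` of `P(H | Z = z)`, the Gaussian with mean `f_dec((I - Aᵀ)⁻¹ z)` and
covariance `v I`. -/
def likelihood (v : ℝ≥0) (p : Params N d k mEnc mDec) (z : Features N k) (h : Features N d) : ℝ :=
  ∏ q : Fin N × Fin d,
    gaussianPDFReal (p.dec.eval (fun j => semSolution p.A z (q.1, j)) q.2) v (h q)

/-- The population loss (negative evidence lower bound)
`E_H [ KL(Q(Z | H) ‖ P(Z)) - E_{Q(Z | H)} [log P(H | Z)] ]` for features with law `μ`. -/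
def loss (v : ℝ≥0) (μ : Measure (Features N d)) (p : Params N d k mEnc mDec) : ℝ :=
  ∫ h, ((InformationTheory.klDiv (posterior p h) (prior N k)).toReal
    - ∫ z, Real.log (likelihood v p z h) ∂(posterior p h)) ∂μ

/-- The acyclicity constraint `∑ t, (Tr[(I + A⁽ᵗ⁾ ∘ A⁽ᵗ⁾)^N] - N) = 0`. -/
def Feasible {T : ℕ} (p : Fin T → Params N d k mEnc mDec) : Prop :=
  ∑ t, (Matrix.trace ((1 + Matrix.hadamard (p t).A (p t).A) ^ N) - (N : ℝ)) = 0

/-- `p` solves the inner optimization: it is feasible, and at every time its loss is minimal among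
all feasible parameters. -/
def IsInnerSolution {T : ℕ} (v : ℝ≥0) (μ : Fin T → Measure (Features N d))
    (p : Fin T → Params N d k mEnc mDec) : Prop :=
  Feasible p ∧ ∀ p' : Fin T → Params N d k mEnc mDec, Feasible p' →
    ∀ t, loss v (μ t) (p t) ≤ loss v (μ t) (p' t)

/-- The causal graph `S` generates features with law `μ` following the normal distribution: `S` is
acyclic, and `μ` is the law of `H = X V + c + E` (`V`, `c` common to all rows), where `X` solves a
linear structural equation model `X = Aᵀ X + Z` whose nonzero coefficients are exactly the edges of
`S`, `Z` is standard Gaussian and `E` is independent Gaussian noise of variance `v`. -/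
def GeneratesNormal (k : ℕ) (v : ℝ≥0) (S : Digraph (Fin N)) (μ : Measure (Features N d)) : Prop :=
  IsAcyclic S ∧ ∃ (A : Matrix (Fin N) (Fin N) ℝ) (V : Matrix (Fin k) (Fin d) ℝ) (c : Fin d → ℝ),
    graphOf A = S ∧ μ = generatedLaw v (fun x => x ᵥ* V + c) A

/-- Structural identifiability of `S` from the law `μ`: no model with a different acyclic graph,
and a decoder of the given size, has the law `μ`. -/
def StructurallyIdentifiable (k mDec : ℕ) (v : ℝ≥0) (S : Digraph (Fin N))
    (μ : Measure (Features N d)) : Prop :=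
  ∀ (θ : MLP (Fin k) (Fin d) mDec) (A : Matrix (Fin N) (Fin N) ℝ),
    IsAcyclic (graphOf A) → generatedLaw v θ.eval A = μ → graphOf A = S

end InstantaneousCausality

end

/-!
At each time the loss is, up to an additive constant, a Kullback-Leibler divergence between two
joint laws of features and latents. Let `K` be the law of `(H, Z)` with `H` distributed as the
observed features `μ` and `Z` drawn from the variational posterior given `H`, and let `J` be the law
of `(H, Z)` in the generative model. Both have densities with respect to `volume ⊗ prior`, namely
`m(h) exp (logRatio h z)`, where `m` is the density of `μ`, and the likelihood. Hence
`KL(K ‖ J) = loss + ∫ log m dμ` (`klDiv_joint`). Perceptrons grow at most linearly and Gaussians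
have second moments, so all log-densities are integrable and the divergence is finite.

So the loss is at least `-∫ log m dμ`, with equality only if `K = J`, and then the marginals for the
features agree: the generative model has the law `μ`. The bound is attained. For the linear model
generating `μ`, the exact posterior is Gaussian, with a mean affine in the features and a covariance
not depending on them, and affine maps are computed by perceptrons with two hidden units per input
(`exists_mlp_eval_eq`, `exists_exact_params`). The density `m` is then read off from Bayes' rule for
these exact parameters, so no marginal law of a nonlinear model has to be computed.

The trace constraint says that every graph is acyclic (`feasible_iff`): with nonnegative weights
`A ∘ A`, the trace counts weighted closed walks of length at most `N`, and by Cayley-Hamilton longer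
closed walks need no separate treatment. Solutions therefore have acyclic graphs and models with law
`μ`, and structural identifiability determines their graphs.
-/

namespace InstantaneousCausality

/-! ### The trace constraint and acyclicity -/

section Acyclicity

variable {N : ℕ}

/-- A nonzero entry of a positive power comes from a directed walk. -/
lemma transGen_of_pow_ne_zero {A B : Matrix (Fin N) (Fin N) ℝ}
    (hAB : ∀ u w, B u w ≠ 0 → A u w ≠ 0) (j : ℕ) (u w : Fin N) (h : (B ^ (j + 1)) u w ≠ 0) :
    Relation.TransGen (graphOf A).Adj u w := by
  induction j generalizing w with
  | zero => exact .single (hAB u w (by simpa using h))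
  | succ j ih =>
    rw [pow_succ, Matrix.mul_apply] at h
    obtain ⟨x, -, hx⟩ := Finset.exists_ne_zero_of_sum_ne_zero h
    exact (ih x (left_ne_zero_of_mul hx)).tail (hAB x w (right_ne_zero_of_mul hx))

lemma pow_nonneg_entries {B : Matrix (Fin N) (Fin N) ℝ} (hB : ∀ u w, 0 ≤ B u w) (j : ℕ)
    (u w : Fin N) : 0 ≤ (B ^ j) u w := by
  induction j generalizing w with
  | zero => rw [pow_zero, Matrix.one_apply]; split_ifs <;> norm_num
  | succ j ih =>
    rw [pow_succ, Matrix.mul_apply]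
    exact Finset.sum_nonneg fun x _ => mul_nonneg (ih x) (hB x w)

/-- With nonnegative weights walks do not cancel: a directed walk makes an entry of some positive
power positive. -/
lemma exists_pow_pos_of_transGen {A B : Matrix (Fin N) (Fin N) ℝ} (hB : ∀ u w, 0 ≤ B u w)
    (hAB : ∀ u w, A u w ≠ 0 → 0 < B u w) {u w : Fin N}
    (h : Relation.TransGen (graphOf A).Adj u w) : ∃ j, 0 < (B ^ (j + 1)) u w := by
  induction h with
  | single h => exact ⟨0, by simpa using hAB _ _ h⟩
  | @tail x y _ h ih =>
    obtain ⟨j, hj⟩ := ih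
    refine ⟨j + 1, ?_⟩
    rw [pow_succ, Matrix.mul_apply]
    exact Finset.sum_pos' (fun z _ => mul_nonneg (pow_nonneg_entries hB _ _ _) (hB _ _))
      ⟨x, Finset.mem_univ _, mul_pos hj (hAB _ _ h)⟩

/-- By Cayley-Hamilton, if the powers `1, …, N` of an `N × N` matrix vanish at a diagonal entry,
then so do all positive powers. -/
lemma pow_diag_eq_zero {B : Matrix (Fin N) (Fin N) ℝ} {x : Fin N}
    (h : ∀ j < N, (B ^ (j + 1)) x x = 0) (j : ℕ) : (B ^ (j + 1)) x x = 0 := by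
  have : Nonempty (Fin N) := ⟨x⟩
  have hdeg : ((Polynomial.X ^ j : Polynomial ℝ) %ₘ B.charpoly).natDegree < N := by
    have := Polynomial.natDegree_modByMonic_lt (Polynomial.X ^ j : Polynomial ℝ) B.charpoly_monic
      fun h1 => by
        have := B.charpoly_natDegree_eq_dim
        rw [h1, Polynomial.natDegree_one] at this
        exact Fintype.card_ne_zero this.symm
    simpa using this
  rw [pow_succ, Matrix.pow_eq_aeval_mod_charpoly, Polynomial.aeval_eq_sum_range' hdeg,
    Finset.sum_mul, Matrix.sum_apply]
  refine Finset.sum_eq_zero fun i hi => ?_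
  rw [smul_mul_assoc, ← pow_succ, Matrix.smul_apply, h i (Finset.mem_range.mp hi), smul_zero]

/-- The excess of the trace counts, with positive coefficients, the weighted closed walks of
length `1, …, N`. -/
lemma trace_one_add_pow_sub (B : Matrix (Fin N) (Fin N) ℝ) :
    Matrix.trace ((1 + B) ^ N) - (N : ℝ) =
      ∑ j ∈ Finset.range N, (N.choose (j + 1) : ℝ) * Matrix.trace (B ^ (j + 1)) := by
  rw [add_comm, (Commute.one_right B).add_pow, Finset.sum_range_succ', Matrix.trace_add,
    Matrix.trace_sum]
  simp only [one_pow, mul_one, pow_zero, Nat.choose_zero_right, Nat.cast_one,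
    Matrix.trace_one, Fintype.card_fin, add_sub_cancel_right]
  refine Finset.sum_congr rfl fun j _ => ?_
  rw [← nsmul_eq_mul', Matrix.trace_smul, nsmul_eq_mul]

lemma trace_constraint_nonneg (A : Matrix (Fin N) (Fin N) ℝ) :
    0 ≤ Matrix.trace ((1 + Matrix.hadamard A A) ^ N) - (N : ℝ) := by
  rw [trace_one_add_pow_sub]
  exact Finset.sum_nonneg fun j _ => mul_nonneg (Nat.cast_nonneg _) (Finset.sum_nonneg fun x _ =>
    pow_nonneg_entries (fun u w => mul_self_nonneg _) _ _ _)

lemma trace_constraint_eq_zero_iff (A : Matrix (Fin N) (Fin N) ℝ) :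
    Matrix.trace ((1 + Matrix.hadamard A A) ^ N) - (N : ℝ) = 0 ↔ IsAcyclic (graphOf A) := by
  have hB : ∀ u w, 0 ≤ (Matrix.hadamard A A) u w := fun u w => mul_self_nonneg _
  have htr : ∀ j, 0 ≤ Matrix.trace (Matrix.hadamard A A ^ j) := fun j =>
    Finset.sum_nonneg fun x _ => pow_nonneg_entries hB _ _ _
  rw [trace_one_add_pow_sub]
  constructor
  · intro h x hx
    rw [Finset.sum_eq_zero_iff_of_nonneg fun j _ => mul_nonneg (Nat.cast_nonneg _) (htr _)] at h
    obtain ⟨j, hj⟩ := exists_pow_pos_of_transGen hB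
      (fun u w huw => mul_self_pos.mpr huw) hx
    refine hj.ne' (pow_diag_eq_zero (fun i hi => ?_) j)
    have h0 : Matrix.trace (Matrix.hadamard A A ^ (i + 1)) = 0 :=
      (mul_eq_zero.mp (h i (Finset.mem_range.mpr hi))).resolve_left
        (Nat.cast_ne_zero.mpr (Nat.choose_pos hi).ne')
    exact (Finset.sum_eq_zero_iff_of_nonneg
      fun y _ => pow_nonneg_entries hB (i + 1) y y).mp h0 x (Finset.mem_univ x)
  · intro h
    refine Finset.sum_eq_zero fun j _ => mul_eq_zero_of_right _ (Finset.sum_eq_zero fun x _ => ?_)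
    by_contra hne
    exact h x (transGen_of_pow_ne_zero (fun u w huw => left_ne_zero_of_mul huw) j x x hne)

lemma feasible_iff {d k mEnc mDec T : ℕ} (p : Fin T → Params N d k mEnc mDec) :
    Feasible p ↔ ∀ t, IsAcyclic (graphOf (p t).A) := by
  simp only [Feasible, ← trace_constraint_eq_zero_iff]
  rw [Finset.sum_eq_zero_iff_of_nonneg fun t _ => trace_constraint_nonneg _]
  simp

/-- The structural equations of an acyclic graph have a unique solution: a nonzero solution of the
homogeneous equations would be nonzero at some variable all of whose causes have value zero. -/
lemma isUnit_det_one_sub_transpose {A : Matrix (Fin N) (Fin N) ℝ} (h : IsAcyclic (graphOf A)) :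
    IsUnit (1 - Aᵀ).det := by
  rw [isUnit_iff_ne_zero]
  intro h0
  obtain ⟨x, hx, hAx⟩ := Matrix.exists_mulVec_eq_zero_iff.mpr h0
  have : Std.Irrefl (Relation.TransGen (graphOf A).Adj) := ⟨h⟩
  have hwf : WellFounded (Relation.TransGen (graphOf A).Adj) :=
    Finite.wellFounded_of_trans_of_irrefl _
  obtain ⟨w, hw, hmin⟩ := hwf.has_min {w | x w ≠ 0} (Function.ne_iff.mp hx)
  have hxw : x w = ∑ u, A u w * x u := by
    have := congrFun hAx w
    rw [Matrix.sub_mulVec, Matrix.one_mulVec, Pi.sub_apply, Pi.zero_apply, sub_eq_zero] at this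
    exact this
  refine hw (hxw.trans (Finset.sum_eq_zero fun u _ => ?_))
  by_contra hne
  exact hmin u (right_ne_zero_of_mul hne) (.single (left_ne_zero_of_mul hne))

end Acyclicity

/-! ### Affine maps as perceptrons -/

/-- Two hidden units per input compute an affine map, since `x = max x 0 - max (-x) 0`. -/
lemma exists_mlp_eval_eq {ι κ : Type} [Fintype ι] [DecidableEq ι] {m : ℕ}
    (hm : 2 * Fintype.card ι ≤ m) (M : Matrix κ ι ℝ) (b : κ → ℝ) :
    ∃ θ : MLP ι κ m, ∀ x, θ.eval x = M *ᵥ x + b := by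
  obtain ⟨e⟩ : Nonempty (ι ⊕ ι ↪ Fin m) :=
    Function.Embedding.nonempty_of_card_le (by simpa [two_mul] using hm)
  have he := e.injective
  refine ⟨⟨Function.extend e
      (Sum.elim (fun i => Pi.single i 1) (fun i => Pi.single i (-1))) 0, 0,
    fun q => Function.extend e (Sum.elim (fun i => M q i) (fun i => -M q i)) 0, b⟩, fun x => ?_⟩
  funext q
  simp only [MLP.eval, Pi.add_apply]
  congr 1
  simp only [Matrix.mulVec, dotProduct]
  rw [← Fintype.sum_of_injective e he (fun s : ι ⊕ ι => Sum.elim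
    (fun i => M q i * max (x i) 0) (fun i => -M q i * max (-x i) 0) s)]
  · rw [Fintype.sum_sum_type, ← Finset.sum_add_distrib]
    refine Finset.sum_congr rfl fun i _ => ?_
    simp only [Sum.elim_inl, Sum.elim_inr]
    rcases le_total 0 (x i) with h | h
    · rw [max_eq_left h, max_eq_right (by linarith)]; ring
    · rw [max_eq_right h, max_eq_left (by linarith)]; ring
  · intro r hr
    rw [Function.extend_apply' _ _ _ hr]
    simp
  · rintro (i | i) <;>
    simp [he.extend_apply, Pi.single_apply]

/-! ### Gaussian densities -/

section Density

/-- The product Gaussian measure has the product of the Gaussian densities as density. -/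
lemma pi_gaussianReal_eq_withDensity {ι : Type*} [Fintype ι] {v : ℝ≥0} (hv : v ≠ 0) :
    Measure.pi (fun _ : ι => gaussianReal 0 v) =
      volume.withDensity fun x => ENNReal.ofReal (∏ i, gaussianPDFReal 0 v (x i)) := by
  refine Measure.pi_eq fun s hs => ?_
  rw [withDensity_apply _ (MeasurableSet.univ_pi hs), volume_pi, Measure.restrict_pi_pi,
    ← ofReal_integral_eq_lintegral_ofReal
      (Integrable.fintype_prod fun i => (integrable_gaussianPDFReal 0 v).restrict)
      (ae_of_all _ fun x => Finset.prod_nonneg fun i _ => gaussianPDFReal_nonneg _ _ _),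
    integral_fintype_prod_eq_prod (fun _ => gaussianPDFReal 0 v),
    ENNReal.ofReal_prod_of_nonneg fun i _ =>
      integral_nonneg fun x => gaussianPDFReal_nonneg _ _ _]
  exact Finset.prod_congr rfl fun i _ => (gaussianReal_apply_eq_integral 0 hv (s i)).symm

lemma prod_gaussianPDFReal_eq {ι : Type*} [Fintype ι] (v : ℝ≥0) (m x : ι → ℝ) :
    ∏ i, gaussianPDFReal (m i) v (x i) =
      (√(2 * Real.pi * v))⁻¹ ^ Fintype.card ι *
        Real.exp (-(∑ i, (x i - m i) ^ 2) / (2 * v)) := by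
  simp only [gaussianPDFReal, Finset.prod_mul_distrib, Finset.prod_const, Finset.card_univ,
    ← Real.exp_sum, ← Finset.sum_div, Finset.sum_neg_distrib]

lemma lintegral_comp_affine {ι : Type*} [Fintype ι] [DecidableEq ι] {L : Matrix ι ι ℝ}
    (hL : L.det ≠ 0) (a : ι → ℝ) {F : (ι → ℝ) → ENNReal} (hF : Measurable F) :
    ∫⁻ x, F (a + L *ᵥ x) = ENNReal.ofReal |L.det⁻¹| * ∫⁻ z, F z := by
  have h := Real.map_matrix_volume_pi_eq_smul_volume_pi hL
  have hmeas : Measurable (Matrix.toLin' L) :=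
    (LinearMap.continuous_of_finiteDimensional (Matrix.toLin' L)).measurable
  calc ∫⁻ x, F (a + L *ᵥ x) = ∫⁻ y, F (a + y) ∂(Measure.map (Matrix.toLin' L) volume) := by
        rw [lintegral_map (by fun_prop) hmeas]; rfl
    _ = _ := by rw [h, lintegral_smul_measure, lintegral_add_left_eq_self F a, smul_eq_mul]

end Density

variable {N d k mEnc mDec : ℕ}

instance (v : ℝ≥0) : IsProbabilityMeasure (noise N d v) := by unfold noise; infer_instance

instance : IsProbabilityMeasure (prior N k) := by unfold prior; infer_instance

lemma noise_eq_withDensity {v : ℝ≥0} (hv : v ≠ 0) :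
    noise N d v = volume.withDensity fun x => ENNReal.ofReal (∏ i, gaussianPDFReal 0 v (x i)) :=
  pi_gaussianReal_eq_withDensity hv

lemma memLp_noise (v : ℝ≥0) (q : Fin N × Fin d) : MemLp (fun x => x q) 2 (noise N d v) :=
  (memLp_id_gaussianReal 2).comp_measurePreserving
    (measurePreserving_eval (fun _ : Fin N × Fin d => gaussianReal 0 v) q)

/-! ### The perceptrons and the posterior -/

section Maps

lemma MLP.continuous_eval {ι κ : Type} [Fintype ι] {m : ℕ} (θ : MLP ι κ m) :
    Continuous θ.eval := by
  unfold MLP.eval Matrix.mulVec dotProduct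
  fun_prop

lemma continuous_nodeMul (B : Matrix (Fin N) (Fin N) ℝ) :
    Continuous (nodeMul B : Features N d → Features N d) := by
  unfold nodeMul
  fun_prop

/-- The mean `(I - Aᵀ) f_enc(h)` of the variational posterior. -/
noncomputable def posteriorMean (p : Params N d k mEnc mDec) (h : Features N d) : Features N k :=
  nodeMul (1 - p.Aᵀ) (p.enc.eval h)

/-- The mean `f_dec((I - Aᵀ)⁻¹ z)` of the likelihood. -/
noncomputable def decodedMean (θ : MLP (Fin k) (Fin d) mDec) (A : Matrix (Fin N) (Fin N) ℝ)
    (z : Features N k) : Features N d :=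
  fun q => θ.eval (fun j => semSolution A z (q.1, j)) q.2

lemma continuous_posteriorMean (p : Params N d k mEnc mDec) : Continuous (posteriorMean p) :=
  (continuous_nodeMul _).comp p.enc.continuous_eval

lemma continuous_decodedMean (θ : MLP (Fin k) (Fin d) mDec) (A : Matrix (Fin N) (Fin N) ℝ) :
    Continuous (decodedMean θ A) := by
  refine continuous_pi fun q => (continuous_apply q.2).comp (θ.continuous_eval.comp ?_)
  exact continuous_pi fun j => (continuous_apply (q.1, j)).comp (continuous_nodeMul _)

end Maps

/-! ### Square integrability -/

section Moments

variable {Ω : Type*} [MeasurableSpace Ω] {P : Measure Ω}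

lemma memLp_mulVec {ι κ : Type*} [Fintype ι] (M : Matrix κ ι ℝ) {X : Ω → ι → ℝ}
    (hX : ∀ i, MemLp (fun ω => X ω i) 2 P) (q : κ) : MemLp (fun ω => (M *ᵥ X ω) q) 2 P :=
  memLp_finsetSum _ fun i _ => (hX i).const_mul (M q i)

lemma memLp_nodeMul (B : Matrix (Fin N) (Fin N) ℝ) {X : Ω → Features N d}
    (hX : ∀ i, MemLp (fun ω => X ω i) 2 P) (q : Fin N × Fin d) :
    MemLp (fun ω => nodeMul B (X ω) q) 2 P :=
  memLp_finsetSum _ fun u _ => (hX (u, q.2)).const_mul (B q.1 u)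

lemma integrable_sum_sq {ι : Type*} [Fintype ι] {X : Ω → ι → ℝ}
    (hX : ∀ i, MemLp (fun ω => X ω i) 2 P) : Integrable (fun ω => ∑ i, X ω i ^ 2) P :=
  integrable_finsetSum _ fun i _ => (hX i).integrable_sq

variable [IsFiniteMeasure P]

/-- A perceptron has linear growth, so it maps square integrable vectors to such vectors. -/
lemma memLp_mlp_eval {ι κ : Type} [Fintype ι] {m : ℕ} (θ : MLP ι κ m) {X : Ω → ι → ℝ}
    (hX : ∀ i, MemLp (fun ω => X ω i) 2 P) (q : κ) : MemLp (fun ω => θ.eval (X ω) q) 2 P :=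
  (memLp_mulVec θ.W₂ (fun r => ((memLp_mulVec θ.W₁ hX r).add (memLp_const (θ.b₁ r))).sup
    (memLp_const 0)) q).add (memLp_const _)

lemma memLp_posteriorMean (p : Params N d k mEnc mDec) {X : Ω → Features N d}
    (hX : ∀ i, MemLp (fun ω => X ω i) 2 P) (q : Fin N × Fin k) :
    MemLp (fun ω => posteriorMean p (X ω) q) 2 P :=
  memLp_nodeMul _ (memLp_mlp_eval p.enc hX) q

lemma memLp_decodedMean (θ : MLP (Fin k) (Fin d) mDec) (A : Matrix (Fin N) (Fin N) ℝ)
    {Z : Ω → Features N k} (hZ : ∀ i, MemLp (fun ω => Z ω i) 2 P) (q : Fin N × Fin d) :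
    MemLp (fun ω => decodedMean θ A (Z ω) q) 2 P :=
  memLp_mlp_eval θ (fun j => memLp_nodeMul _ hZ (q.1, j)) q.2

end Moments

/-! ### Log-densities of the posterior and of the likelihood -/

section LogDensity

/-- The logarithm at `z` of the density of the posterior given `h` relative to the prior. -/
noncomputable def logRatio (p : Params N d k mEnc mDec) (h : Features N d) (z : Features N k) : ℝ :=
  Real.log |(p.scale : Matrix (Fin N × Fin k) (Fin N × Fin k) ℝ).det⁻¹| + (∑ i, z i ^ 2) / 2 -
    (∑ i, ((p.scale : Matrix (Fin N × Fin k) (Fin N × Fin k) ℝ)⁻¹ *ᵥ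
      (z - posteriorMean p h)) i ^ 2) / 2

lemma det_scale_ne_zero (p : Params N d k mEnc mDec) :
    (p.scale : Matrix (Fin N × Fin k) (Fin N × Fin k) ℝ).det ≠ 0 :=
  ((Matrix.isUnit_iff_isUnit_det _).mp p.scale.isUnit).ne_zero

lemma likelihood_eq (v : ℝ≥0) (p : Params N d k mEnc mDec) (z : Features N k)
    (h : Features N d) : likelihood v p z h =
      (√(2 * Real.pi * v))⁻¹ ^ (N * d) *
        Real.exp (-(∑ i, (h i - decodedMean p.dec p.A z i) ^ 2) / (2 * v)) := by
  have := prod_gaussianPDFReal_eq v (decodedMean p.dec p.A z) h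
  rwa [Fintype.card_prod, Fintype.card_fin, Fintype.card_fin] at this

lemma likelihood_pos {v : ℝ≥0} (hv : v ≠ 0) (p : Params N d k mEnc mDec) (z : Features N k)
    (h : Features N d) : 0 < likelihood v p z h :=
  Finset.prod_pos fun _ _ => gaussianPDFReal_pos _ _ _ hv

lemma log_likelihood {v : ℝ≥0} (hv : v ≠ 0) (p : Params N d k mEnc mDec) (z : Features N k)
    (h : Features N d) : Real.log (likelihood v p z h) =
      Real.log ((√(2 * Real.pi * v))⁻¹ ^ (N * d)) -
        (∑ i, (h i - decodedMean p.dec p.A z i) ^ 2) / (2 * v) := by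
  have hv' : (0 : ℝ) < v := NNReal.coe_pos.mpr (pos_iff_ne_zero.mpr hv)
  have hc : (0 : ℝ) < (√(2 * Real.pi * v))⁻¹ ^ (N * d) := by positivity
  rw [likelihood_eq, Real.log_mul hc.ne' (Real.exp_ne_zero _), Real.log_exp]
  ring

lemma continuous_logRatio (p : Params N d k mEnc mDec) :
    Continuous fun q : Features N d × Features N k => logRatio p q.1 q.2 := by
  have := continuous_posteriorMean p
  unfold logRatio Matrix.mulVec dotProduct
  fun_prop

lemma measurable_logRatio (p : Params N d k mEnc mDec) (h : Features N d) :
    Measurable (logRatio p h) :=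
  ((continuous_logRatio p).comp (by fun_prop : Continuous fun z => (h, z))).measurable

lemma continuous_likelihood (v : ℝ≥0) (p : Params N d k mEnc mDec) :
    Continuous fun q : Features N d × Features N k => likelihood v p q.2 q.1 := by
  have := continuous_decodedMean p.dec p.A
  simp only [likelihood_eq]
  fun_prop

variable {Ω : Type*} [MeasurableSpace Ω] {P : Measure Ω} [IsFiniteMeasure P]
  {X : Ω → Features N d} {Z : Ω → Features N k}

lemma integrable_logRatio (p : Params N d k mEnc mDec)
    (hX : ∀ i, MemLp (fun ω => X ω i) 2 P) (hZ : ∀ i, MemLp (fun ω => Z ω i) 2 P) :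
    Integrable (fun ω => logRatio p (X ω) (Z ω)) P :=
  ((integrable_const _).add ((integrable_sum_sq hZ).div_const 2)).sub
    ((integrable_sum_sq (memLp_mulVec _ fun i =>
      (hZ i).sub (memLp_posteriorMean p hX i))).div_const 2)

lemma integrable_log_likelihood {v : ℝ≥0} (hv : v ≠ 0) (p : Params N d k mEnc mDec)
    (hX : ∀ i, MemLp (fun ω => X ω i) 2 P) (hZ : ∀ i, MemLp (fun ω => Z ω i) 2 P) :
    Integrable (fun ω => Real.log (likelihood v p (Z ω) (X ω))) P := by
  simp only [log_likelihood hv]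
  exact (integrable_const _).sub ((integrable_sum_sq fun i =>
    (hX i).sub (memLp_decodedMean p.dec p.A hZ i)).div_const _)

end LogDensity

/-- The posterior is the prior weighted by `exp (logRatio p h ·)`. -/
lemma posterior_eq_withDensity (p : Params N d k mEnc mDec) (h : Features N d) :
    posterior p h =
      (prior N k).withDensity fun z => ENNReal.ofReal (Real.exp (logRatio p h z)) := by
  set L : Matrix (Fin N × Fin k) (Fin N × Fin k) ℝ := p.scale.val
  have hdet : L.det ≠ 0 := det_scale_ne_zero p
  set φ : Features N k → ℝ := fun x => ∏ i, gaussianPDFReal 0 1 (x i)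
  have hφm : Measurable φ := by
    have := measurable_gaussianPDFReal 0 1
    fun_prop
  have hφ0 : ∀ x, 0 ≤ φ x := fun x => Finset.prod_nonneg fun i _ => gaussianPDFReal_nonneg _ _ _
  have hprior : prior N k = volume.withDensity fun x => ENNReal.ofReal (φ x) :=
    noise_eq_withDensity one_ne_zero
  have hmap : Measurable fun ξ : Features N k => posteriorMean p h + L *ᵥ ξ := by
    unfold Matrix.mulVec dotProduct
    fun_prop
  have hinv : Measurable fun z : Features N k => L⁻¹ *ᵥ (z - posteriorMean p h) := by
    unfold Matrix.mulVec dotProduct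
    fun_prop
  have hlr := measurable_logRatio p h
  -- the change of variables `z = posteriorMean p h + L ξ` in the prior density
  have hkey : ∀ z, |L.det⁻¹| * φ (L⁻¹ *ᵥ (z - posteriorMean p h)) =
      φ z * Real.exp (logRatio p h z) := by
    intro z
    have h0 : 0 < |L.det⁻¹| := abs_pos.mpr (inv_ne_zero hdet)
    rw [logRatio, add_sub_assoc, Real.exp_add, Real.exp_log h0]
    simp only [φ, prod_gaussianPDFReal_eq 1 (fun _ => (0 : ℝ)), sub_zero, NNReal.coe_one, mul_one]
    have hexp : ∀ a b : ℝ, Real.exp (-a / 2) = Real.exp (-b / 2) * Real.exp (b / 2 - a / 2) :=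
      fun a b => by rw [← Real.exp_add]; congr 1; ring
    rw [hexp _ (∑ i, z i ^ 2)]
    ring
  refine Measure.ext_of_lintegral _ fun f hf => ?_
  change ∫⁻ z, f z ∂((prior N k).map fun ξ => posteriorMean p h + L *ᵥ ξ) = _
  rw [lintegral_map hf hmap, lintegral_withDensity_eq_lintegral_mul _ (by fun_prop) hf, hprior,
    lintegral_withDensity_eq_lintegral_mul _ (by fun_prop) (by fun_prop),
    lintegral_withDensity_eq_lintegral_mul _ (by fun_prop) (by fun_prop)]
  have := lintegral_comp_affine hdet (posteriorMean p h)
    (F := fun z => ENNReal.ofReal (φ (L⁻¹ *ᵥ (z - posteriorMean p h))) * f z) (by fun_prop)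
  simp only [add_sub_cancel_left, Matrix.mulVec_mulVec,
    Matrix.nonsing_inv_mul L hdet.isUnit, Matrix.one_mulVec] at this
  simp only [Pi.mul_apply]
  rw [this, ← lintegral_const_mul _ (by fun_prop)]
  refine lintegral_congr fun z => ?_
  rw [← mul_assoc, ← mul_assoc, ← ENNReal.ofReal_mul (abs_nonneg _), hkey,
    ENNReal.ofReal_mul (hφ0 z)]

/-! ### The loss as a Kullback-Leibler divergence -/

section KL

variable {α : Type*} [MeasurableSpace α]

/-- The log-likelihood ratio of a measure given by a positive density is the logarithm of the
density. -/
lemma llr_withDensity_ofReal {J : Measure α} [SigmaFinite J] {f : α → ℝ} (hf : Measurable f)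
    (hpos : ∀ x, 0 < f x) :
    llr (J.withDensity fun x => ENNReal.ofReal (f x)) J
      =ᵐ[J.withDensity fun x => ENNReal.ofReal (f x)] fun x => Real.log (f x) := by
  refine (withDensity_absolutelyContinuous J _).ae_le ?_
  filter_upwards [Measure.rnDeriv_withDensity J hf.ennreal_ofReal] with x hx
  rw [llr, hx, ENNReal.toReal_ofReal (hpos x).le]

lemma toReal_klDiv_withDensity_ofReal {J : Measure α} [IsProbabilityMeasure J] {f : α → ℝ}
    (hf : Measurable f) (hpos : ∀ x, 0 < f x)
    [IsProbabilityMeasure (J.withDensity fun x => ENNReal.ofReal (f x))] :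
    (InformationTheory.klDiv (J.withDensity fun x => ENNReal.ofReal (f x)) J).toReal =
      ∫ x, Real.log (f x) ∂(J.withDensity fun x => ENNReal.ofReal (f x)) := by
  rw [InformationTheory.toReal_klDiv_of_measure_eq (withDensity_absolutelyContinuous J _)
    (by simp)]
  exact integral_congr_ae (llr_withDensity_ofReal hf hpos)

end KL

/-- The latent `(I - Aᵀ) f_enc(h) + L ξ` drawn from the posterior given the features `q.1 = h` by
means of the noise `q.2 = ξ`. -/
noncomputable def posteriorSample (p : Params N d k mEnc mDec)
    (q : Features N d × Features N k) : Features N k :=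
  posteriorMean p q.1 + p.scale.val *ᵥ q.2

lemma measurable_posteriorSample (p : Params N d k mEnc mDec) :
    Measurable (posteriorSample p) := by
  have := continuous_posteriorMean p
  have h2 : Continuous fun ξ : Features N k => p.scale.val *ᵥ ξ := by
    unfold Matrix.mulVec dotProduct
    fun_prop
  refine Continuous.measurable ?_
  unfold posteriorSample
  fun_prop

lemma measurable_posteriorSample_mk (p : Params N d k mEnc mDec) (h : Features N d) :
    Measurable fun ξ => posteriorSample p (h, ξ) :=
  (measurable_posteriorSample p).comp measurable_prodMk_left

lemma posterior_eq_map (p : Params N d k mEnc mDec) (h : Features N d) :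
    posterior p h = (prior N k).map fun ξ => posteriorSample p (h, ξ) := rfl

/-- The joint law of the features and of a latent drawn from the variational posterior. -/
noncomputable def variationalJoint (p : Params N d k mEnc mDec) (μ : Measure (Features N d)) :
    Measure (Features N d × Features N k) :=
  (μ.prod (prior N k)).map fun q => (q.1, posteriorSample p q)

/-- The joint law of the features and of the latent in the generative model. -/
noncomputable def modelJoint (v : ℝ≥0) (p : Params N d k mEnc mDec) :
    Measure (Features N d × Features N k) :=
  ((prior N k).prod (noise N d v)).map fun q => (decodedMean p.dec p.A q.1 + q.2, q.1)

lemma measurable_variational_map (p : Params N d k mEnc mDec) :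
    Measurable fun q : Features N d × Features N k =>
      (q.1, posteriorSample p q) :=
  measurable_fst.prodMk (measurable_posteriorSample p)

lemma measurable_model_map (p : Params N d k mEnc mDec) :
    Measurable fun q : Features N k × Features N d => (decodedMean p.dec p.A q.1 + q.2, q.1) := by
  have := (continuous_decodedMean p.dec p.A).measurable
  fun_prop

instance (p : Params N d k mEnc mDec) (μ : Measure (Features N d)) [IsProbabilityMeasure μ] :
    IsProbabilityMeasure (variationalJoint p μ) :=
  Measure.isProbabilityMeasure_map (measurable_variational_map p).aemeasurable

instance (v : ℝ≥0) (p : Params N d k mEnc mDec) : IsProbabilityMeasure (modelJoint v p) :=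
  Measure.isProbabilityMeasure_map (measurable_model_map p).aemeasurable

instance (p : Params N d k mEnc mDec) (h : Features N d) :
    IsProbabilityMeasure (posterior p h) :=
  Measure.isProbabilityMeasure_map (measurable_posteriorSample_mk p h).aemeasurable

lemma map_fst_variationalJoint (p : Params N d k mEnc mDec) (μ : Measure (Features N d))
    [SFinite μ] : (variationalJoint p μ).map Prod.fst = μ := by
  rw [variationalJoint, Measure.map_map measurable_fst (measurable_variational_map p)]
  exact Measure.map_fst_prod.trans (by simp)

lemma map_fst_modelJoint (v : ℝ≥0) (p : Params N d k mEnc mDec) :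
    (modelJoint v p).map Prod.fst = generatedLaw v p.dec.eval p.A := by
  rw [modelJoint, Measure.map_map measurable_fst (measurable_model_map p)]
  rfl

lemma modelJoint_eq_withDensity {v : ℝ≥0} (hv : v ≠ 0) (p : Params N d k mEnc mDec) :
    modelJoint v p = ((volume : Measure (Features N d)).prod (prior N k)).withDensity
      fun q => ENNReal.ofReal (likelihood v p q.2 q.1) := by
  have hlik := (continuous_likelihood v p).measurable
  have hpdf := measurable_gaussianPDFReal 0 v
  refine Measure.ext_of_lintegral _ fun f hf => ?_
  have hF : Measurable fun q : Features N k × Features N d =>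
      f (decodedMean p.dec p.A q.1 + q.2, q.1) := hf.comp (measurable_model_map p)
  rw [modelJoint, lintegral_map hf (measurable_model_map p), lintegral_prod _ hF.aemeasurable,
    lintegral_withDensity_eq_lintegral_mul _ hlik.ennreal_ofReal hf,
    lintegral_prod_symm _ (hlik.ennreal_ofReal.mul hf).aemeasurable]
  refine lintegral_congr fun z => ?_
  have hz : Measurable fun e : Features N d => f (decodedMean p.dec p.A z + e, z) := by fun_prop
  rw [noise_eq_withDensity hv, lintegral_withDensity_eq_lintegral_mul _ (by fun_prop) hz]
  refine (lintegral_congr fun e => ?_).trans (lintegral_add_left_eq_self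
    (fun h => ENNReal.ofReal (likelihood v p z h) * f (h, z)) (decodedMean p.dec p.A z))
  simp only [Pi.mul_apply, likelihood_eq, prod_gaussianPDFReal_eq v (fun _ => (0 : ℝ)),
    Pi.add_apply, add_sub_cancel_left, sub_zero, Fintype.card_prod, Fintype.card_fin]

/-- Integration against the variational joint law is iterated integration, over the posterior given
the features and then over the features. -/
lemma lintegral_variationalJoint (p : Params N d k mEnc mDec) (μ : Measure (Features N d))
    [SFinite μ] {f : Features N d × Features N k → ENNReal} (hf : Measurable f) :
    ∫⁻ q, f q ∂(variationalJoint p μ) = ∫⁻ h, ∫⁻ z, f (h, z) ∂(posterior p h) ∂μ := by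
  have hF : Measurable fun q => f (q.1, posteriorSample p q) :=
    hf.comp (measurable_variational_map p)
  rw [variationalJoint, lintegral_map hf (measurable_variational_map p),
    lintegral_prod _ hF.aemeasurable]
  refine lintegral_congr fun h => ?_
  have hfh : Measurable fun z => f (h, z) := hf.comp measurable_prodMk_left
  rw [posterior_eq_map, lintegral_map hfh (measurable_posteriorSample_mk p h)]

lemma variationalJoint_eq_withDensity (p : Params N d k mEnc mDec) {m : Features N d → ℝ}
    (hm : Measurable m) (hpos : ∀ h, 0 < m h) :
    variationalJoint p (volume.withDensity fun h => ENNReal.ofReal (m h)) =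
      ((volume : Measure (Features N d)).prod (prior N k)).withDensity
        fun q => ENNReal.ofReal (m q.1 * Real.exp (logRatio p q.1 q.2)) := by
  have hlr := (continuous_logRatio p).measurable
  have hlre : Measurable fun q : Features N d × Features N k =>
      ENNReal.ofReal (Real.exp (logRatio p q.1 q.2)) := hlr.exp.ennreal_ofReal
  have hdens : Measurable fun q : Features N d × Features N k =>
      ENNReal.ofReal (m q.1 * Real.exp (logRatio p q.1 q.2)) :=
    ((hm.comp measurable_fst).mul hlr.exp).ennreal_ofReal
  refine Measure.ext_of_lintegral _ fun f hf => ?_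
  have hfh : ∀ h, Measurable fun z => f (h, z) := fun h => hf.comp measurable_prodMk_left
  have hlreh : ∀ h, Measurable fun z => ENNReal.ofReal (Real.exp (logRatio p h z)) :=
    fun h => (measurable_logRatio p h).exp.ennreal_ofReal
  -- the inner integral, as an integral over the prior, is measurable in the features
  have hinner : ∀ h, ∫⁻ z, f (h, z) ∂(posterior p h) =
      ∫⁻ z, ENNReal.ofReal (Real.exp (logRatio p h z)) * f (h, z) ∂(prior N k) := fun h => by
    rw [posterior_eq_withDensity, lintegral_withDensity_eq_lintegral_mul _ (hlreh h) (hfh h)]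
    rfl
  have hG : Measurable fun h =>
      ∫⁻ z, ENNReal.ofReal (Real.exp (logRatio p h z)) * f (h, z) ∂(prior N k) :=
    Measurable.lintegral_prod_right' (hlre.mul hf)
  rw [lintegral_variationalJoint p _ hf]
  simp only [hinner]
  rw [lintegral_withDensity_eq_lintegral_mul _ hm.ennreal_ofReal hG,
    lintegral_withDensity_eq_lintegral_mul _ hdens hf,
    lintegral_prod _ (hdens.mul hf).aemeasurable]
  refine lintegral_congr fun h => ?_
  simp only [Pi.mul_apply]
  have hprod : Measurable fun z => ENNReal.ofReal (Real.exp (logRatio p h z)) * f (h, z) :=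
    (hlreh h).mul (hfh h)
  rw [← lintegral_const_mul _ hprod]
  refine lintegral_congr fun z => ?_
  rw [ENNReal.ofReal_mul (hpos h).le, mul_assoc]

/-- Drawing the latent from the posterior by means of `ξ`, the integrand of the loss is an integral
over the noise `ξ`. -/
lemma loss_integrand_eq {v : ℝ≥0} (hv : v ≠ 0) (p : Params N d k mEnc mDec) (h : Features N d) :
    (InformationTheory.klDiv (posterior p h) (prior N k)).toReal
      - ∫ z, Real.log (likelihood v p z h) ∂(posterior p h) =
      ∫ ξ, (logRatio p h (posteriorSample p (h, ξ)) -
        Real.log (likelihood v p (posteriorSample p (h, ξ)) h)) ∂(prior N k) := by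
  have hlrh := measurable_logRatio p h
  have hlikh : Measurable fun z => likelihood v p z h :=
    ((continuous_likelihood v p).comp (by fun_prop : Continuous fun z => (h, z))).measurable
  have hX : ∀ i, MemLp (fun _ : Features N k => h i) 2 (prior N k) := fun i => memLp_const _
  have hZ : ∀ i, MemLp (fun ξ => posteriorSample p (h, ξ) i) 2 (prior N k) := fun i =>
    (memLp_const (posteriorMean p h i)).add (memLp_mulVec _ (fun i => memLp_noise 1 i) i)
  have hKL : (InformationTheory.klDiv (posterior p h) (prior N k)).toReal =
      ∫ z, logRatio p h z ∂(posterior p h) := by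
    have : IsProbabilityMeasure ((prior N k).withDensity
        fun z => ENNReal.ofReal (Real.exp (logRatio p h z))) := by
      rw [← posterior_eq_withDensity]; infer_instance
    rw [posterior_eq_withDensity,
      toReal_klDiv_withDensity_ofReal hlrh.exp fun z => Real.exp_pos _]
    simp only [Real.log_exp]
  rw [hKL, posterior_eq_map,
    integral_map (measurable_posteriorSample_mk p h).aemeasurable hlrh.aestronglyMeasurable,
    integral_map (measurable_posteriorSample_mk p h).aemeasurable
      hlikh.log.aestronglyMeasurable,
    integral_sub (integrable_logRatio p hX hZ) (integrable_log_likelihood hv p hX hZ)]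

/-- The loss exceeds the Kullback-Leibler divergence between the two joint laws, which is finite, by
the entropy `-∫ log m dμ` of the features, which does not depend on the parameters. -/
lemma klDiv_joint {v : ℝ≥0} (hv : v ≠ 0) (p : Params N d k mEnc mDec) {m : Features N d → ℝ}
    (hm : Measurable m) (hpos : ∀ h, 0 < m h) {μ : Measure (Features N d)}
    [IsProbabilityMeasure μ] (hμ : μ = volume.withDensity fun h => ENNReal.ofReal (m h))
    (hmom : ∀ i, MemLp (fun h : Features N d => h i) 2 μ)
    (hlog : Integrable (fun h => Real.log (m h)) μ) :
    InformationTheory.klDiv (variationalJoint p μ) (modelJoint v p) ≠ ⊤ ∧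
      (InformationTheory.klDiv (variationalJoint p μ) (modelJoint v p)).toReal =
        loss v μ p + ∫ h, Real.log (m h) ∂μ := by
  have hlr := (continuous_logRatio p).measurable
  have hlik := (continuous_likelihood v p).measurable
  have hlikpos : ∀ q : Features N d × Features N k, 0 < likelihood v p q.2 q.1 :=
    fun q => likelihood_pos hv p q.2 q.1
  -- the density of one joint law with respect to the other
  set f : Features N d × Features N k → ℝ :=
    fun q => m q.1 * Real.exp (logRatio p q.1 q.2) / likelihood v p q.2 q.1 with hf_def
  have hf : Measurable f := ((hm.comp measurable_fst).mul hlr.exp).div hlik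
  have hfpos : ∀ q, 0 < f q := fun q =>
    div_pos (mul_pos (hpos _) (Real.exp_pos _)) (hlikpos q)
  have hlogf : ∀ q, Real.log (f q) =
      Real.log (m q.1) + (logRatio p q.1 q.2 - Real.log (likelihood v p q.2 q.1)) := by
    intro q
    rw [hf_def, Real.log_div (mul_pos (hpos _) (Real.exp_pos _)).ne' (hlikpos q).ne',
      Real.log_mul (hpos _).ne' (Real.exp_ne_zero _), Real.log_exp, add_sub_assoc]
  have hKJ : variationalJoint p μ =
      (modelJoint v p).withDensity fun q => ENNReal.ofReal (f q) := by
    rw [hμ, variationalJoint_eq_withDensity p hm hpos, modelJoint_eq_withDensity hv,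
      ← withDensity_mul _ hlik.ennreal_ofReal hf.ennreal_ofReal]
    congr 1
    funext q
    rw [Pi.mul_apply, ← ENNReal.ofReal_mul (hlikpos q).le, hf_def,
      mul_div_cancel₀ _ (hlikpos q).ne']
  -- integrability under `μ.prod prior`, where the latent is an affine function of the noise
  have hX : ∀ i, MemLp (fun q : Features N d × Features N k => q.1 i) 2
      (μ.prod (prior N k)) := fun i => (hmom i).comp_fst _
  have hξ : ∀ i, MemLp (fun q : Features N d × Features N k => q.2 i) 2
      (μ.prod (prior N k)) := fun i => (memLp_noise 1 i).comp_snd _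
  have hZ : ∀ i, MemLp (fun q => posteriorSample p q i) 2 (μ.prod (prior N k)) := fun i =>
    (memLp_posteriorMean p hX i).add (memLp_mulVec _ hξ i)
  have hint : Integrable (fun q => logRatio p q.1 (posteriorSample p q) -
      Real.log (likelihood v p (posteriorSample p q) q.1))
      (μ.prod (prior N k)) :=
    (integrable_logRatio p hX hZ).sub (integrable_log_likelihood hv p hX hZ)
  have hlogfst : Integrable (fun q : Features N d × Features N k => Real.log (m q.1))
      (μ.prod (prior N k)) := hlog.comp_fst _
  have hloss : loss v μ p = ∫ q, (logRatio p q.1 (posteriorSample p q) -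
      Real.log (likelihood v p (posteriorSample p q) q.1))
      ∂(μ.prod (prior N k)) := by
    rw [integral_prod _ hint]
    exact integral_congr_ae (ae_of_all _ (loss_integrand_eq hv p))
  have hmeas : Measurable fun q => Real.log (f q) := hf.log
  have hintK : Integrable (fun q => Real.log (f q)) (variationalJoint p μ) := by
    rw [variationalJoint, integrable_map_measure hmeas.aestronglyMeasurable
      (measurable_variational_map p).aemeasurable]
    refine (hlogfst.add hint).congr (ae_of_all _ fun q => ?_)
    exact (hlogf (q.1, posteriorSample p q)).symm
  have hprob : IsProbabilityMeasure
      ((modelJoint v p).withDensity fun q => ENNReal.ofReal (f q)) := by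
    rw [← hKJ]; infer_instance
  constructor
  · rw [hKJ] at hintK ⊢
    exact InformationTheory.klDiv_ne_top (withDensity_absolutelyContinuous _ _)
      (hintK.congr (llr_withDensity_ofReal hf hfpos).symm)
  · have : (InformationTheory.klDiv (variationalJoint p μ) (modelJoint v p)).toReal =
        ∫ q, Real.log (f q) ∂(variationalJoint p μ) := by
      rw [hKJ]
      exact toReal_klDiv_withDensity_ofReal hf hfpos
    rw [this, variationalJoint, integral_map (measurable_variational_map p).aemeasurable
      hmeas.aestronglyMeasurable, hloss]
    simp only [hlogf]
    rw [integral_add hlogfst hint, add_comm]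
    congr 1
    have := integral_fun_fst (μ := μ) (ν := prior N k) fun h => Real.log (m h)
    simpa using this

/-! ### Exact posterior of the linear Gaussian model -/

section Linear

open scoped Kronecker

lemma nodeMul_eq_mulVec (B : Matrix (Fin N) (Fin N) ℝ) (x : Features N d) :
    nodeMul B x = (B ⊗ₖ (1 : Matrix (Fin d) (Fin d) ℝ)) *ᵥ x := by
  funext q
  simp [nodeMul, Matrix.mulVec, dotProduct, Fintype.sum_prod_type, Matrix.one_apply]

lemma nodeMul_nodeMul (B C : Matrix (Fin N) (Fin N) ℝ) (x : Features N d) :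
    nodeMul B (nodeMul C x) = nodeMul (B * C) x := by
  simp only [nodeMul_eq_mulVec, Matrix.mulVec_mulVec, ← Matrix.mul_kronecker_mul, one_mul]

/-- A Gram factor `Uᵀ U` of the precision matrix `I + v⁻¹ Wᵀ W` of the posterior. -/
lemma exists_precision_factor {ι κ : Type*} [Fintype ι] [DecidableEq ι] [Fintype κ] {v : ℝ}
    (hv : 0 < v) (W : Matrix κ ι ℝ) :
    ∃ U : Matrix ι ι ℝ, IsUnit U.det ∧ Uᵀ * U = 1 + v⁻¹ • (Wᵀ * W) := by
  have hpd : (1 + v⁻¹ • (Wᵀ * W)).PosDef := by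
    refine Matrix.PosDef.one.add_posSemidef (Matrix.PosSemidef.smul ?_ (inv_nonneg.mpr hv.le))
    simpa using Matrix.posSemidef_conjTranspose_mul_self W
  obtain ⟨U, hU⟩ : ∃ U : Matrix ι ι ℝ, 1 + v⁻¹ • (Wᵀ * W) = star U * U := by
    open scoped MatrixOrder in
    exact CStarAlgebra.nonneg_iff_eq_star_mul_self.mp hpd.posSemidef.nonneg
  rw [Matrix.star_eq_conjTranspose, Matrix.conjTranspose_eq_transpose_of_trivial] at hU
  refine ⟨U, ?_, hU.symm⟩
  have hdet := (Matrix.isUnit_iff_isUnit_det _).mp hpd.isUnit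
  rw [hU, Matrix.det_mul] at hdet
  exact isUnit_of_mul_isUnit_right hdet

/-- Completing the square: with precision `Uᵀ U = I + v⁻¹ Wᵀ W` and mean `a` solving
`Uᵀ U a = v⁻¹ Wᵀ r`, the quadratic forms of posterior, prior and likelihood agree up to a term
independent of `z`. -/
lemma sum_sq_precision {ι κ : Type*} [Fintype ι] [DecidableEq ι] [Fintype κ] {v : ℝ}
    {W : Matrix κ ι ℝ} {U : Matrix ι ι ℝ} (hU : Uᵀ * U = 1 + v⁻¹ • (Wᵀ * W)) {a : ι → ℝ}
    {r : κ → ℝ} (ha : (Uᵀ * U) *ᵥ a = v⁻¹ • (Wᵀ *ᵥ r)) (z : ι → ℝ) :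
    ∑ i, (U *ᵥ (z - a)) i ^ 2 =
      ∑ i, z i ^ 2 + v⁻¹ * ∑ q, (r q - (W *ᵥ z) q) ^ 2 +
        (∑ i, (U *ᵥ a) i ^ 2 - v⁻¹ * ∑ q, r q ^ 2) := by
  have hsq : ∀ x : ι → ℝ, ∑ i, x i ^ 2 = x ⬝ᵥ x := fun x => by simp only [dotProduct, sq]
  have hsq' : ∀ x : κ → ℝ, ∑ i, x i ^ 2 = x ⬝ᵥ x := fun x => by simp only [dotProduct, sq]
  have hUU : ∀ y, U *ᵥ z ⬝ᵥ U *ᵥ y = z ⬝ᵥ (Uᵀ * U) *ᵥ y := fun y => by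
    rw [← Matrix.mulVec_mulVec, Matrix.dotProduct_mulVec z, Matrix.vecMul_transpose]
  have hWW : ∀ y, z ⬝ᵥ Wᵀ *ᵥ y = W *ᵥ z ⬝ᵥ y := fun y => by
    rw [Matrix.dotProduct_mulVec z, Matrix.vecMul_transpose]
  have h1 : ∑ q, (r q - (W *ᵥ z) q) ^ 2 = (r - W *ᵥ z) ⬝ᵥ (r - W *ᵥ z) :=
    hsq' (r - W *ᵥ z)
  have h2 : U *ᵥ z ⬝ᵥ U *ᵥ z = z ⬝ᵥ z + v⁻¹ * (W *ᵥ z ⬝ᵥ W *ᵥ z) := by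
    rw [hUU, hU, Matrix.add_mulVec, Matrix.one_mulVec, Matrix.smul_mulVec, dotProduct_add,
      dotProduct_smul, ← Matrix.mulVec_mulVec, hWW, smul_eq_mul]
  have h3 : U *ᵥ z ⬝ᵥ U *ᵥ a = v⁻¹ * (W *ᵥ z ⬝ᵥ r) := by
    rw [hUU, ha, dotProduct_smul, hWW, smul_eq_mul]
  rw [h1, hsq, hsq, hsq, hsq', Matrix.mulVec_sub]
  simp only [sub_dotProduct, dotProduct_sub]
  rw [dotProduct_comm (U *ᵥ a), dotProduct_comm r (W *ᵥ z), h2, h3]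
  ring

/-- For a linear model with acyclic graph, perceptrons of the given sizes represent the model and
its exact posterior: by Bayes' rule the two log-densities then differ by a term (the log-density of
the features) that does not depend on `z`. -/
lemma exists_exact_params (hEnc : 2 * (N * d) ≤ mEnc) (hDec : 2 * k ≤ mDec) {v : ℝ≥0}
    (hv : v ≠ 0) {A : Matrix (Fin N) (Fin N) ℝ} (hA : IsAcyclic (graphOf A))
    (V : Matrix (Fin k) (Fin d) ℝ) (c : Fin d → ℝ) :
    ∃ p : Params N d k mEnc mDec, p.A = A ∧ (p.dec.eval = fun x => x ᵥ* V + c) ∧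
      ∀ h z, Real.log (likelihood v p z h) - logRatio p h z =
        Real.log (likelihood v p 0 h) - logRatio p h 0 := by
  have hv' : (0 : ℝ) < v := NNReal.coe_pos.mpr (pos_iff_ne_zero.mpr hv)
  obtain ⟨dec, hdec⟩ := exists_mlp_eval_eq (m := mDec) (by simpa using hDec) Vᵀ c
  -- the mean of the likelihood is the affine map `z ↦ W z + c'`
  let W : Matrix (Fin N × Fin d) (Fin N × Fin k) ℝ :=
    fun q s => (1 - Aᵀ)⁻¹ q.1 s.1 * V s.2 q.2
  let c' : Features N d := fun q => c q.2
  have hmean : ∀ z, decodedMean dec A z = W *ᵥ z + c' := by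
    intro z
    funext q
    simp only [decodedMean, hdec, Pi.add_apply, c', W, Matrix.mulVec, dotProduct, semSolution,
      nodeMul, Matrix.transpose_apply, Fintype.sum_prod_type, Finset.mul_sum]
    rw [Finset.sum_comm]
    congr 1
    exact Finset.sum_congr rfl fun u _ => Finset.sum_congr rfl fun j _ => by ring
  obtain ⟨U, hUdet, hU⟩ := exists_precision_factor hv' W
  have hUUdet : IsUnit (Uᵀ * U).det := by
    rw [Matrix.det_mul, Matrix.det_transpose]
    exact hUdet.mul hUdet
  -- the mean of the posterior is the affine map `h ↦ M (h - c')`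
  let M : Matrix (Fin N × Fin k) (Fin N × Fin d) ℝ := (v : ℝ)⁻¹ • ((Uᵀ * U)⁻¹ * Wᵀ)
  let B : Matrix (Fin N × Fin k) (Fin N × Fin k) ℝ := (1 - Aᵀ)⁻¹ ⊗ₖ 1
  obtain ⟨enc, henc⟩ := exists_mlp_eval_eq (m := mEnc) (by simpa using hEnc) (B * M)
    (B *ᵥ (-(M *ᵥ c')))
  let p : Params N d k mEnc mDec :=
    ⟨enc, Matrix.GeneralLinearGroup.mk'' U⁻¹ (Matrix.isUnit_nonsing_inv_det U hUdet), dec, A⟩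
  have hpm : ∀ h, posteriorMean p h = M *ᵥ (h - c') := by
    intro h
    have : enc.eval h = nodeMul (1 - Aᵀ)⁻¹ (M *ᵥ (h - c')) := by
      rw [henc, nodeMul_eq_mulVec, ← Matrix.mulVec_mulVec, ← Matrix.mulVec_add, Matrix.mulVec_sub,
        ← sub_eq_add_neg]
    change nodeMul (1 - Aᵀ) (enc.eval h) = _
    rw [this, nodeMul_nodeMul, Matrix.mul_nonsing_inv _ (isUnit_det_one_sub_transpose hA),
      nodeMul_eq_mulVec, Matrix.one_kronecker_one, Matrix.one_mulVec]
  have hscale : (p.scale : Matrix (Fin N × Fin k) (Fin N × Fin k) ℝ)⁻¹ = U :=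
    Matrix.nonsing_inv_nonsing_inv U hUdet
  refine ⟨p, rfl, ?_, fun h z => ?_⟩
  · funext x
    rw [← Matrix.mulVec_transpose]
    exact hdec x
  · have ha : (Uᵀ * U) *ᵥ posteriorMean p h = (v : ℝ)⁻¹ • (Wᵀ *ᵥ (h - c')) := by
      rw [hpm, Matrix.smul_mulVec, Matrix.mulVec_smul, Matrix.mulVec_mulVec,
        Matrix.mul_nonsing_inv_cancel_left _ _ hUUdet]
    have hlik : ∀ z, ∑ i, (h i - decodedMean p.dec p.A z i) ^ 2 =
        ∑ q, ((h - c') q - (W *ᵥ z) q) ^ 2 := fun z =>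
      Finset.sum_congr rfl fun i _ => by
        change (h i - decodedMean dec A z i) ^ 2 = _
        rw [hmean, Pi.add_apply, Pi.sub_apply]
        ring
    simp only [log_likelihood hv, logRatio, hscale, sum_sq_precision hU ha, hlik]
    field_simp
    ring

end Linear

/-! ### Optimality -/

section Optimality

lemma memLp_generatedLaw (v : ℝ≥0) (p : Params N d k mEnc mDec) (i : Fin N × Fin d) :
    MemLp (fun h => h i) 2 (generatedLaw v p.dec.eval p.A) := by
  rw [← map_fst_modelJoint, modelJoint, Measure.map_map measurable_fst (measurable_model_map p),
    memLp_map_measure_iff (measurable_pi_apply i).aestronglyMeasurable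
      (measurable_fst.comp (measurable_model_map p)).aemeasurable]
  exact (memLp_decodedMean p.dec p.A (fun s => (memLp_noise 1 s).comp_fst _) i).add
    ((memLp_noise v i).comp_snd _)

/-- Some parameters with acyclic graph minimize the loss among all parameters, and parameters with
the same loss generate the law of the features. -/
lemma exists_optimal_params (hEnc : 2 * (N * d) ≤ mEnc) (hDec : 2 * k ≤ mDec) {v : ℝ≥0}
    (hv : v ≠ 0) {S : Digraph (Fin N)} {μ : Measure (Features N d)}
    (hgen : GeneratesNormal k v S μ) :
    ∃ p₀ : Params N d k mEnc mDec, IsAcyclic (graphOf p₀.A) ∧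
      ∀ p : Params N d k mEnc mDec, loss v μ p₀ ≤ loss v μ p ∧
        (loss v μ p ≤ loss v μ p₀ → generatedLaw v p.dec.eval p.A = μ) := by
  obtain ⟨hS, A, V, c, rfl, hμ⟩ := hgen
  obtain ⟨p₀, hA, hdec, hp₀⟩ := exists_exact_params (mEnc := mEnc) hEnc hDec hv hS V c
  have hμ₀ : μ = generatedLaw v p₀.dec.eval p₀.A := by rw [hμ, hdec, hA]
  -- the density of the features, by Bayes' rule at `z = 0`
  set l : Features N d → ℝ := fun h => Real.log (likelihood v p₀ 0 h) - logRatio p₀ h 0 with hl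
  have hlm : Measurable l := by
    have h0 : Continuous fun h : Features N d => (h, (0 : Features N k)) := by fun_prop
    exact ((continuous_likelihood v p₀).comp h0).measurable.log.sub
      ((continuous_logRatio p₀).comp h0).measurable
  set m : Features N d → ℝ := fun h => Real.exp (l h) with hm
  have hmm : Measurable m := hlm.exp
  have hmpos : ∀ h, 0 < m h := fun h => Real.exp_pos _
  have hjoint : variationalJoint p₀ (volume.withDensity fun h => ENNReal.ofReal (m h)) =
      modelJoint v p₀ := by
    rw [variationalJoint_eq_withDensity p₀ hmm hmpos, modelJoint_eq_withDensity hv]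
    congr 1
    funext q
    have hlq : l q.1 + logRatio p₀ q.1 q.2 = Real.log (likelihood v p₀ q.2 q.1) := by
      simp only [hl, ← hp₀ q.1 q.2, sub_add_cancel]
    rw [hm, ← Real.exp_add, hlq, Real.exp_log (likelihood_pos hv _ _ _)]
  have hdens : μ = volume.withDensity fun h => ENNReal.ofReal (m h) := by
    rw [hμ₀, ← map_fst_modelJoint, ← hjoint, map_fst_variationalJoint]
  have hprob : IsProbabilityMeasure μ := by
    rw [hμ₀, ← map_fst_modelJoint]
    exact Measure.isProbabilityMeasure_map measurable_fst.aemeasurable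
  have hmom : ∀ i, MemLp (fun h : Features N d => h i) 2 μ := fun i => by
    rw [hμ₀]
    exact memLp_generatedLaw v p₀ i
  have hlog : Integrable (fun h => Real.log (m h)) μ := by
    simp only [hm, Real.log_exp]
    exact (integrable_log_likelihood hv p₀ hmom fun i => memLp_const 0).sub
      (integrable_logRatio p₀ hmom fun i => memLp_const 0)
  have hKL := fun p : Params N d k mEnc mDec => klDiv_joint hv p hmm hmpos hdens hmom hlog
  -- the divergence vanishes at the exact posterior
  have h₀ : loss v μ p₀ + ∫ h, Real.log (m h) ∂μ = 0 := by
    rw [← (hKL p₀).2, (InformationTheory.klDiv_eq_zero_iff).mpr, ENNReal.toReal_zero]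
    rw [← hjoint, ← hdens]
  refine ⟨p₀, by rwa [hA], fun p => ?_⟩
  have hnonneg : 0 ≤ loss v μ p + ∫ h, Real.log (m h) ∂μ :=
    (hKL p).2 ▸ ENNReal.toReal_nonneg
  refine ⟨by linarith, fun hle => ?_⟩
  have hzero : loss v μ p + ∫ h, Real.log (m h) ∂μ = 0 := by linarith
  rw [← (hKL p).2, ENNReal.toReal_eq_zero_iff, or_iff_left (hKL p).1,
    InformationTheory.klDiv_eq_zero_iff] at hzero
  rw [← map_fst_modelJoint, ← hzero, map_fst_variationalJoint]

end Optimality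

end InstantaneousCausality

theorem theorem1 (T N d k mEnc mDec : ℕ) (v : ℝ≥0) (hv : v ≠ 0)
    (hEnc : 2 * (N * d) ≤ mEnc) (hDec : 2 * k ≤ mDec)
    (S : Fin T → Digraph (Fin N))
    (μ : Fin T → Measure (InstantaneousCausality.Features N d))
    (hgen : ∀ t, InstantaneousCausality.GeneratesNormal k v (S t) (μ t))
    (hid : ∀ t, InstantaneousCausality.StructurallyIdentifiable k mDec v (S t) (μ t)) :
    (∃ p : Fin T → InstantaneousCausality.Params N d k mEnc mDec,
      InstantaneousCausality.IsInnerSolution v μ p) ∧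
    ∀ p : Fin T → InstantaneousCausality.Params N d k mEnc mDec,
      InstantaneousCausality.IsInnerSolution v μ p →
        ∀ t, InstantaneousCausality.graphOf (p t).A = S t := by
  choose p₀ hacyclic hopt using fun t =>
    InstantaneousCausality.exists_optimal_params hEnc hDec hv (hgen t)
  have hfeas := (InstantaneousCausality.feasible_iff p₀).mpr hacyclic
  refine ⟨⟨p₀, hfeas, fun p' _ t => (hopt t (p' t)).1⟩, fun p hp t => ?_⟩
  exact hid t (p t).dec (p t).A ((InstantaneousCausality.feasible_iff p).mp hp.1 t)
    ((hopt t (p t)).2 (hp.2 p₀ hfeas t))
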